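/- Let $\Omega_0$ be the space of continuous paths $\omega:\mathbb R\to\mathbb R^3$ with $\omega(0)=0$, with the topology of uniform convergence on bounded intervals and its Borel $\sigma$-field, and let $\mathbb P$ be the law on $\Omega_0$ of (two-sided, standard) three-dimensional Brownian increments. Let $\mathcal M_{\mathrm{si}}(\Omega_0)$ be the set of processes with stationary increments, that is, of the probability measures on $\Omega_0$ invariant under all the maps $(\theta_t\omega)(s)=\omega(t+s)-\omega(t)$, $t\in\mathbb R$. For $a<b$ let $\mathcal F_{[a,b]}$ be the $\sigma$-field generated by the increments $\omega(s)-\omega(r)$, $a\le r<s\le b$. For $\mathbb Q\in\mathcal M_{\mathrm{si}}(\Omega_0)$ let $\mathbb Q_{0,\omega}$ be the regular conditional distribution of $\mathbb Q$ given the $\sigma$-field generated by the increments $\omega(s)-\omega(r)$, $r<s\le 0$, and put $$H_t(\mathbb Q|\mathbb P)=\mathbb E^{\mathbb Q}\Big[\sup_f\Big\{\int f\,d\mathbb Q_{0,\omega}-\log\int e^f\,d\mathbb P\Big\}\Big],\qquad t>0,$$ the supremum being over bounded continuous $\mathcal F_{[0,t]}$-measurable functions $f$. The specific relative entropy is $H(\mathbb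 Q|\mathbb P)=H_1(\mathbb Q|\mathbb P)\in[0,\infty]$ (the entropy per unit time: $H_t=tH$ for all $t>0$). For $\eta>0$ and $x\in\mathbb R^3$ let $V(x)=1/|x|$ (with $V(0)=\infty$), $V_\eta(x)=(\eta^2+|x|^2)^{-1/2}$ and $Y_\eta=V-V_\eta\ge 0$. Then: 1. For every finite constant $C$, $$\lim_{\eta\downarrow0}\ \sup_{\substack{\mathbb Q\in\mathcal M_{\mathrm{si}}(\Omega_0)\\ H(\mathbb Q|\mathbb P)\le C}}\ \sup_{0<\varepsilon\le1}\ \varepsilon\,\mathbb E^{\mathbb Q}\Big[\int_0^\infty e^{-\varepsilon t}\,Y_\eta\big(\omega(t)-\omega(0)\big)\,dt\Big]=0.$$ 2. For every $\delta>0$ there is a finite constant $C(\delta)$ such that for all $0<\varepsilon\le1$ and all $\mathbb Q\in\mathcal M_{\mathrm{si}}(\Omega_0)$ with $H(\mathbb Q|\mathbb P)<\infty$, $$\mathbb E^{\mathbb Q}\Big[\varepsilon\int_0^\infty\frac{e^{-\varepsilon t}}{|\omega(t)-\omega(0)|}\,dt\Big]\le\delta\,H(\mathbb Q|\mathbb P)+C(\delta).$$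 -/

import Mathlib

open MeasureTheory ProbabilityTheory Filter Set
open scoped ENNReal NNReal Topology BoundedContinuousFunction

namespace Polaron

/-- Three-dimensional Euclidean space. -/
abbrev E3 : Type := EuclideanSpace ℝ (Fin 3)

noncomputable instance : MeasurableSpace C(ℝ, E3) := borel _

instance : BorelSpace C(ℝ, E3) := ⟨rfl⟩

/-- The space of continuous paths `ω : ℝ → ℝ³` with `ω 0 = 0`, with the topology of uniform
convergence on compact time intervals (the compact-open topology) and its Borel `σ`-algebra. -/
abbrev PathSpace : Type := {ω : C(ℝ, E3) // ω 0 = 0}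

theorem isClosed_setOf_apply_zero : IsClosed {ω : C(ℝ, E3) | ω 0 = 0} :=
  isClosed_eq (ContinuousEvalConst.continuous_eval_const 0) continuous_const

instance : PolishSpace PathSpace :=
  isClosed_setOf_apply_zero.polishSpace

/-- The time shift on increments: `(θ_t ω)(s) = ω (t + s) - ω t`. -/
def shift (t : ℝ) (ω : PathSpace) : PathSpace :=
  ⟨⟨fun s => ω.1 (t + s) - ω.1 t, by fun_prop⟩, by simp⟩

/-- Processes with stationary increments: the probability measures on `PathSpace` that are
invariant under all time shifts `θ_t`, `t ∈ ℝ`. -/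
def StationaryIncrements : Set (ProbabilityMeasure PathSpace) :=
  {Q | ∀ t : ℝ, MeasurePreserving (shift t) (Q : Measure PathSpace) (Q : Measure PathSpace)}

/-- `P` is the law of (two-sided, standard) three-dimensional Brownian increments: increments over
successive time intervals are independent, and `ω t - ω s` is centred Gaussian with covariance
`(t - s) • Id` for `s ≤ t`. -/
structure IsBrownianIncrementLaw (P : ProbabilityMeasure PathSpace) : Prop where
  indep : HasIndepIncrements (fun (t : ℝ) (ω : PathSpace) => ω.1 t) (P : Measure PathSpace)
  gaussian : ∀ s t : ℝ, s ≤ t →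
    HasLaw (fun ω : PathSpace => ω.1 t - ω.1 s)
      ((stdGaussian E3).map (fun x => √(t - s) • x)) (P : Measure PathSpace)

/-- The `σ`-algebra `F_[a,b]` generated by the increments `ω s - ω r`, `a ≤ r < s ≤ b`. -/
@[reducible] def incrementAlgebra (a b : ℝ) : MeasurableSpace PathSpace :=
  ⨆ (r : ℝ) (s : ℝ) (_ : a ≤ r ∧ r < s ∧ s ≤ b),
    MeasurableSpace.comap (fun ω : PathSpace => ω.1 s - ω.1 r) inferInstance

/-- The `σ`-algebra of the past, generated by the increments `ω s - ω r`, `r < s ≤ 0`. -/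
@[reducible] def pastAlgebra : MeasurableSpace PathSpace :=
  ⨆ (r : ℝ) (s : ℝ) (_ : r < s ∧ s ≤ 0),
    MeasurableSpace.comap (fun ω : PathSpace => ω.1 s - ω.1 r) inferInstance

/-- Relative entropy of `μ` with respect to `ν` on the `σ`-algebra `F`: the supremum of
`∫ f dμ - log ∫ exp f dν` over the bounded continuous `F`-measurable functions `f`. The choice
`f = 0` contributes the value `0`, so that taking `ENNReal.ofReal` does not change the supremum. -/
noncomputable def relEntropyOn (μ ν : Measure PathSpace) (F : MeasurableSpace PathSpace) : ℝ≥0∞ :=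
  ⨆ (f : PathSpace →ᵇ ℝ) (_ : Measurable[F] (f : PathSpace → ℝ)),
    ENNReal.ofReal (∫ ω, f ω ∂μ - Real.log (∫ ω, Real.exp (f ω) ∂ν))

/-- `H_t(Q | P)`: the `Q`-expectation of the relative entropy on `F_[0,t]`, with respect to `P`, of
the regular conditional distribution of `Q` given the past. -/
noncomputable def entropyUpTo (t : ℝ) (Q P : ProbabilityMeasure PathSpace) : ℝ≥0∞ :=
  ∫⁻ ω, relEntropyOn (condExpKernel (Q : Measure PathSpace) pastAlgebra ω)
    (P : Measure PathSpace) (incrementAlgebra 0 t)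
    ∂(Q : Measure PathSpace)

/-- The specific relative entropy `H(Q | P)`, i.e. the entropy per unit time `H_1(Q | P)`. (For
`Q` with stationary increments, `H_t(Q | P) = t * H(Q | P)` for all `t > 0`.) -/
noncomputable def specificEntropy (Q P : ProbabilityMeasure PathSpace) : ℝ≥0∞ :=
  entropyUpTo 1 Q P

/-- The Coulomb potential `V(x) = 1 / |x|`, with `V(0) = ∞`. -/
noncomputable def coulomb (x : E3) : ℝ≥0∞ := (ENNReal.ofReal ‖x‖)⁻¹

/-- The regularised Coulomb potential `V_η(x) = (η² + |x|²)^(-1/2)`. -/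
noncomputable def coulombReg (η : ℝ) (x : E3) : ℝ≥0∞ :=
  ENNReal.ofReal (1 / √(η ^ 2 + ‖x‖ ^ 2))

/-- The singular part `Y_η = V - V_η`. For `η > 0`, `V_η` is finite and `V_η ≤ V`, so this is the
genuine difference; in particular `Y_η(0) = ∞`. -/
noncomputable def coulombSing (η : ℝ) (x : E3) : ℝ≥0∞ := coulomb x - coulombReg η x

/-- The averaged term `E^Q [ε ∫_0^∞ exp(-ε t) W(ω t - ω 0) dt]` for a nonnegative potential `W`. -/
noncomputable def averaged (ε : ℝ) (W : E3 → ℝ≥0∞) (Q : ProbabilityMeasure PathSpace) : ℝ≥0∞ :=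
  ∫⁻ ω, (ENNReal.ofReal ε *
    ∫⁻ t in Ioi (0 : ℝ), ENNReal.ofReal (Real.exp (-ε * t)) * W (ω.1 t - ω.1 0))
    ∂(Q : Measure PathSpace)

end Polaron

namespace Polaron

/-! The estimate behind both claims is that the averaged `Y_η` is at most `2 (H + 2) / lam` whenever
`lam * √η` is below an absolute constant. Taking `lam` large and then `η` small gives the first
claim. The second follows by adding the regular part, since `V_η ≤ 1 / η`.

The estimate rests on the entropy inequality: given the past, the mean of a functional of the path
on `[0,1]` is at most its relative entropy plus its log exponential moment under Brownian motion.
The functional may depend on the past through a starting point `x`, so the exponential moment must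
be bounded uniformly in `x`. With `x = -ω(-a)`, stationarity turns the increment started at the
present into the value of the path at a time after `a`, so one unit of entropy controls each unit
time interval.

The uniform exponential moment is Khasminskii's lemma. Interpolation gives `Y_η(y) ≤ √η |y|^(-3/2)`.
The exponent exceeds 1, which produces the small factor, and is below 2, so that the Brownian mean
of `|x + ω(t)|^(-3/2)`, of order `t^(-3/4)`, is integrable at `t = 0`.

Test functions must be bounded and continuous, so `Y_η` is replaced by `(V_σ - V_η)⁺` and time
integrals by sums over a grid of mesh `1 / N`. The bounds depend on neither `σ` nor `N`: averaging
over the offset of the grid recovers the time integral exactly, and Fatou removes `σ`. -/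

/-! ### Gaussian moments of order -3/2, uniformly in the centre. -/

theorem gaussianReal_zero_one_le_volume : gaussianReal 0 1 ≤ (volume : Measure ℝ) := by
  rw [gaussianReal_of_var_ne_zero _ one_ne_zero]
  calc volume.withDensity (gaussianPDF 0 1) ≤ volume.withDensity 1 := by
        refine withDensity_mono (ae_of_all _ fun x => ?_)
        simp only [gaussianPDF, gaussianPDFReal, Pi.one_apply, ENNReal.ofReal_le_one]
        refine mul_le_one₀ (inv_le_one_of_one_le₀ ?_) (Real.exp_nonneg _) ?_
        · rw [Real.one_le_sqrt]
          have := Real.pi_gt_three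
          norm_num
          linarith
        · rw [Real.exp_le_one_iff]
          have := sq_nonneg (x - 0)
          norm_num at this ⊢
          linarith
    _ = volume := withDensity_one

theorem lintegral_indicator_enorm_rpow_lt_top :
    ∫⁻ u : ℝ, (Icc (0 : ℝ) 1).indicator (fun u => ‖u‖ₑ ^ (-(1 / 2) : ℝ)) u < ∞ := by
  rw [lintegral_indicator measurableSet_Icc, setLIntegral_congr Ioc_ae_eq_Icc.symm]
  have h : IntegrableOn (fun u : ℝ => u ^ (-(1 / 2) : ℝ)) (Ioc 0 1) := by
    have := intervalIntegral.intervalIntegrable_rpow' (a := 0) (b := 1) (r := -(1 / 2))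
      (by norm_num)
    rwa [intervalIntegrable_iff_integrableOn_Ioc_of_le zero_le_one] at this
  have h2 := h.lintegral_lt_top
  refine lt_of_eq_of_lt (setLIntegral_congr_fun measurableSet_Ioc fun u hu => ?_) h2
  rw [Real.enorm_eq_ofReal hu.1.le, ENNReal.ofReal_rpow_of_pos hu.1]

/-- The Gaussian density is at most 1, so the singular part near the origin is bounded by a Lebesgue
integral, and translation invariance removes `x`. Away from the origin the integrand is at most 1.
-/
theorem exists_lintegral_gaussianReal_le :
    ∃ c : ℝ≥0, ∀ x : ℝ, ∫⁻ z, ‖x + z‖ₑ ^ (-(1 / 2) : ℝ) ∂(gaussianReal 0 1) ≤ c := by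
  set h : ℝ → ℝ≥0∞ := (Icc (0 : ℝ) 1).indicator (fun u => ‖u‖ₑ ^ (-(1 / 2) : ℝ)) with hh
  have hm : Measurable h := by
    refine Measurable.indicator ?_ measurableSet_Icc
    fun_prop
  set I := ∫⁻ u : ℝ, h u with hI
  have hIt : I ≠ ∞ := lintegral_indicator_enorm_rpow_lt_top.ne
  refine ⟨(I + I + 1).toNNReal, fun x => ?_⟩
  rw [ENNReal.coe_toNNReal (by simp [hIt])]
  have key : ∀ u : ℝ, ‖u‖ₑ ^ (-(1 / 2) : ℝ) ≤ h u + h (-u) + 1 := by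
    intro u
    by_cases h1 : |u| ≤ 1
    · rcases le_total 0 u with h0 | h0
      · have : h u = ‖u‖ₑ ^ (-(1 / 2) : ℝ) := by
          rw [hh, indicator_of_mem]
          exact ⟨h0, (abs_le.1 h1).2⟩
        rw [this, add_assoc]
        exact le_self_add
      · have : h (-u) = ‖u‖ₑ ^ (-(1 / 2) : ℝ) := by
          rw [hh, indicator_of_mem, enorm_neg]
          exact ⟨by linarith, by linarith [(abs_le.1 h1).1]⟩
        rw [this, add_comm (h u), add_assoc]
        exact le_self_add
    · refine le_trans ?_ le_add_self
      refine ENNReal.rpow_le_one_of_one_le_of_neg ?_ (by norm_num)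
      rw [Real.enorm_eq_ofReal_abs, ENNReal.one_le_ofReal]
      linarith
  calc ∫⁻ z, ‖x + z‖ₑ ^ (-(1 / 2) : ℝ) ∂(gaussianReal 0 1)
      ≤ ∫⁻ z, (h (x + z) + h (-(x + z)) + 1) ∂(gaussianReal 0 1) :=
        lintegral_mono fun z => key _
    _ = ∫⁻ z, (h (x + z) + h (-(x + z))) ∂(gaussianReal 0 1) + 1 := by
        rw [lintegral_add_right _ measurable_const]; simp
    _ ≤ (∫⁻ z, (h (x + z) + h (-(x + z)))) + 1 := by
        exact add_le_add_left (lintegral_mono' gaussianReal_zero_one_le_volume le_rfl) _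
    _ = I + I + 1 := by
        rw [lintegral_add_left (by fun_prop), lintegral_add_left_eq_self h x,
          lintegral_add_left_eq_self (fun z => h (-z)) x, lintegral_neg_eq_self h]

/-- Reduces a three-dimensional singularity to three independent one-dimensional ones, each still
integrable because `1/2 < 1`. -/
theorem enorm_rpow_le_prod (y : E3) :
    ‖y‖ₑ ^ (-(3 / 2) : ℝ) ≤ ∏ i : Fin 3, ‖y i‖ₑ ^ (-(1 / 2) : ℝ) := by
  have h : ∀ i, ‖y‖ₑ ^ (-(1 / 2) : ℝ) ≤ ‖y i‖ₑ ^ (-(1 / 2) : ℝ) := by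
    intro i
    have : ‖y i‖ₑ ≤ ‖y‖ₑ := by
      rw [enorm_le_iff_norm_le]
      exact PiLp.norm_apply_le y i
    rw [ENNReal.rpow_neg, ENNReal.rpow_neg]
    gcongr
  calc ‖y‖ₑ ^ (-(3 / 2) : ℝ) = ∏ _i : Fin 3, ‖y‖ₑ ^ (-(1 / 2) : ℝ) := by
        rw [Finset.prod_const, Finset.card_univ, Fintype.card_fin, ← ENNReal.rpow_mul_natCast]
        norm_num
    _ ≤ _ := Finset.prod_le_prod' fun i _ => h i

theorem exists_lintegral_stdGaussian_le :
    ∃ c : ℝ≥0, ∀ x : E3, ∫⁻ z, ‖x + z‖ₑ ^ (-(3 / 2) : ℝ) ∂(stdGaussian E3) ≤ c := by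
  obtain ⟨c, hc⟩ := exists_lintegral_gaussianReal_le
  refine ⟨c ^ 3, fun x => ?_⟩
  rw [← map_pi_eq_stdGaussian, lintegral_map (by fun_prop) (by fun_prop)]
  calc ∫⁻ w, ‖x + WithLp.toLp 2 w‖ₑ ^ (-(3 / 2) : ℝ)
          ∂(Measure.pi fun _ : Fin 3 => gaussianReal 0 1)
      ≤ ∫⁻ w, ∏ i : Fin 3, ‖x i + w i‖ₑ ^ (-(1 / 2) : ℝ)
          ∂(Measure.pi fun _ : Fin 3 => gaussianReal 0 1) :=
        lintegral_mono fun w => enorm_rpow_le_prod _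
    _ = ∏ i : Fin 3, ∫⁻ w, ‖x i + w i‖ₑ ^ (-(1 / 2) : ℝ)
          ∂(Measure.pi fun _ : Fin 3 => gaussianReal 0 1) := by
        have hi := iIndepFun_pi (μ := fun _ : Fin 3 => gaussianReal 0 1)
          (X := fun i u => ‖x i + u‖ₑ ^ (-(1 / 2) : ℝ)) (fun i => by fun_prop)
        exact lintegral_prod_eq_prod_lintegral_of_indepFun Finset.univ _ hi
          (fun i => by fun_prop)
    _ = ∏ i : Fin 3, ∫⁻ u, ‖x i + u‖ₑ ^ (-(1 / 2) : ℝ) ∂(gaussianReal 0 1) := by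
        refine Finset.prod_congr rfl fun i _ => ?_
        exact (measurePreserving_eval (fun _ : Fin 3 => gaussianReal 0 1) i).lintegral_comp
          (f := fun u => ‖x i + u‖ₑ ^ (-(1 / 2) : ℝ)) (by fun_prop)
    _ ≤ ∏ _i : Fin 3, (c : ℝ≥0∞) := Finset.prod_le_prod' fun i _ => hc _
    _ = _ := by simp

/-- Brownian scaling: the factor `√(t - s)` comes out with power `-3/2`, and the rescaled centre is
harmless because the Gaussian bound is uniform in it. -/
theorem exists_lintegral_brownian_le :
    ∃ c : ℝ≥0, ∀ P : ProbabilityMeasure PathSpace, IsBrownianIncrementLaw P →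
      ∀ s t : ℝ, s < t → ∀ x : E3,
        ∫⁻ ω, ‖x + (ω.1 t - ω.1 s)‖ₑ ^ (-(3 / 2) : ℝ) ∂(P : Measure PathSpace)
          ≤ c * ENNReal.ofReal ((t - s) ^ (-(3 / 4) : ℝ)) := by
  obtain ⟨c, hc⟩ := exists_lintegral_stdGaussian_le
  refine ⟨c, fun P hP s t hst x => ?_⟩
  have hts : 0 < t - s := sub_pos.2 hst
  have hr : 0 < √(t - s) := Real.sqrt_pos.2 hts
  rw [(hP.gaussian s t hst.le).lintegral_comp (f := fun y => ‖x + y‖ₑ ^ (-(3 / 2) : ℝ))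
    (by fun_prop), lintegral_map (by fun_prop) (by fun_prop)]
  have e : ∀ z : E3, ‖x + √(t - s) • z‖ₑ ^ (-(3 / 2) : ℝ)
      = ENNReal.ofReal ((t - s) ^ (-(3 / 4) : ℝ)) * ‖(√(t - s))⁻¹ • x + z‖ₑ ^ (-(3 / 2) : ℝ) := by
    intro z
    have : x + √(t - s) • z = √(t - s) • ((√(t - s))⁻¹ • x + z) := by
      rw [smul_add, smul_inv_smul₀ hr.ne']
    rw [this, enorm_smul, ENNReal.mul_rpow_of_ne_top enorm_ne_top enorm_ne_top,
      Real.enorm_eq_ofReal hr.le, ENNReal.ofReal_rpow_of_pos hr, Real.sqrt_eq_rpow,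
      ← Real.rpow_mul hts.le]
    norm_num
  simp_rw [e]
  rw [lintegral_const_mul _ (by fun_prop), mul_comm]
  gcongr
  exact hc _

/-! ### A discrete Khasminskii lemma for random walks. -/

/-- Expand the product and sort the terms by the smallest index `k` at which `f` is chosen. This is
the form to which the Markov property at step `k` applies. -/
theorem prod_range_one_add {R : Type*} [CommSemiring R] (n : ℕ) (f : ℕ → R) :
    ∏ i ∈ Finset.range n, (1 + f i)
      = 1 + ∑ k ∈ Finset.range n,
        f k * ∏ i ∈ Finset.range (n - (k + 1)), (1 + f (k + 1 + i)) := by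
  induction n generalizing f with
  | zero => simp
  | succ n ih =>
    rw [Finset.prod_range_succ', mul_add, mul_one, Finset.sum_range_succ']
    conv_lhs => enter [1]; rw [ih]
    simp only [Nat.add_sub_add_right, zero_add, Nat.add_sub_cancel]
    have e : ∀ a b : ℕ, a + 1 + 1 + b = a + 1 + b + 1 := fun a b => by ring
    have e' : ∀ b : ℕ, 1 + b = b + 1 := fun b => by ring
    simp only [e, e']
    ring

section Khasminskii

variable {Ω E : Type*} {mΩ : MeasurableSpace Ω} {P : Measure Ω} [IsProbabilityMeasure P]
  [AddCommGroup E] [MeasurableSpace E] [MeasurableAdd₂ E]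

/-- The product of a function along the random walk started at `x` at time `m`. -/
noncomputable def walkProd (X : ℕ → Ω → E) (f : E → ℝ≥0∞) (m j : ℕ) (x : E) (ω : Ω) : ℝ≥0∞ :=
  ∏ i ∈ Finset.range j, (1 + f (x + ∑ l ∈ Finset.Ico m (m + i + 1), X l ω))

/-- The Markov property of the random walk. -/
theorem lintegral_mul_walkProd_le {X : ℕ → Ω → E} (hX : ∀ i, Measurable (X i))
    (hi : iIndepFun X P) {f : E → ℝ≥0∞} (hf : Measurable f) (m k j : ℕ) (x : E) {G : ℝ≥0∞}
    (hG : ∀ y, ∫⁻ ω, walkProd X f (m + k + 1) j y ω ∂P ≤ G) :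
    ∫⁻ ω, f (x + ∑ l ∈ Finset.Ico m (m + k + 1), X l ω) *
        walkProd X f (m + k + 1) j (x + ∑ l ∈ Finset.Ico m (m + k + 1), X l ω) ω ∂P
      ≤ (∫⁻ ω, f (x + ∑ l ∈ Finset.Ico m (m + k + 1), X l ω) ∂P) * G := by
  set S := Finset.Ico m (m + k + 1) with hS
  set T := Finset.Ico (m + k + 1) (m + k + 1 + j) with hT
  have hST : Disjoint S T := Finset.Ico_disjoint_Ico_consecutive _ _ _
  have hind := hi.indepFun_finset S T hST hX
  set U : Ω → (S → E) := fun ω i => X i ω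
  set V : Ω → (T → E) := fun ω i => X i ω
  have hU : Measurable U := measurable_pi_lambda _ fun i => hX i
  have hV : Measurable V := measurable_pi_lambda _ fun i => hX i
  -- The later product as a function of its starting point and of the steps in `T` only; these are
  -- independent of the steps in `S`, which determine the starting point.
  set F : E → (T → E) → ℝ≥0∞ := fun y v => ∏ i ∈ Finset.range j,
    (1 + f (y + ∑ l : T, if l.1 < m + k + 1 + i + 1 then v l else 0))
  have hF : Measurable (Function.uncurry F) := by
    refine Finset.measurable_prod _ fun i _ => ?_
    refine measurable_const.add (hf.comp (measurable_fst.add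
      (Finset.measurable_sum _ fun l _ => ?_)))
    split_ifs
    · exact (measurable_pi_apply l).comp measurable_snd
    · exact measurable_const
  have hFV : ∀ y ω, walkProd X f (m + k + 1) j y ω = F y (V ω) := by
    intro y ω
    refine Finset.prod_congr rfl fun i hij => ?_
    rw [Finset.sum_coe_sort T (fun l => if l < m + k + 1 + i + 1 then X l ω else 0),
      ← Finset.sum_filter]
    congr 4
    ext l
    rw [Finset.mem_range] at hij
    simp only [hT, Finset.mem_filter, Finset.mem_Ico]
    omega
  have hSU : ∀ ω, x + ∑ l ∈ S, X l ω = x + ∑ l : S, U ω l := by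
    intro ω
    rw [Finset.sum_coe_sort S (fun l => X l ω)]
  have hs : Measurable fun u : S → E => x + ∑ l : S, u l := by fun_prop
  simp_rw [hFV, hSU] at hG ⊢
  have hmap : P.map (fun ω => (U ω, V ω)) = (P.map U).prod (P.map V) :=
    (indepFun_iff_map_prod_eq_prod_map_map hU.aemeasurable hV.aemeasurable).1 hind
  have : IsProbabilityMeasure (P.map V) := Measure.isProbabilityMeasure_map hV.aemeasurable
  have hm2 : Measurable fun p : (S → E) × (T → E) =>
      f (x + ∑ l : S, p.1 l) * F (x + ∑ l : S, p.1 l) p.2 :=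
    (hf.comp (hs.comp measurable_fst)).mul
      (hF.comp ((hs.comp measurable_fst).prodMk measurable_snd))
  rw [← lintegral_map (f := fun p : (S → E) × (T → E) =>
      f (x + ∑ l : S, p.1 l) * F (x + ∑ l : S, p.1 l) p.2) hm2 (hU.prodMk hV), hmap,
    lintegral_prod _ hm2.aemeasurable,
    ← lintegral_map (f := fun u : S → E => f (x + ∑ l : S, u l)) (hf.comp hs) hU,
    ← lintegral_mul_const G (f := fun u : S → E => f (x + ∑ l : S, u l)) (hf.comp hs)]
  refine lintegral_mono fun u => ?_
  have hFy : ∀ y, Measurable (F y) := fun y => hF.comp measurable_prodMk_left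
  simp only
  rw [lintegral_const_mul _ (hFy _), lintegral_map (hFy _) hV]
  gcongr
  exact hG _

/-- A discrete Khasminskii lemma. -/
theorem lintegral_walkProd_le_two {X : ℕ → Ω → E} (hX : ∀ i, Measurable (X i))
    (hi : iIndepFun X P) {f : E → ℝ≥0∞} (hf : Measurable f) {B : ℝ≥0} (hB : ∀ y, f y ≤ B) (N : ℕ)
    (hα : ∀ m j x, j ≤ N → ∑ k ∈ Finset.range j,
      ∫⁻ ω, f (x + ∑ l ∈ Finset.Ico m (m + k + 1), X l ω) ∂P ≤ 1 / 2) (m : ℕ) (x : E) :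
    ∫⁻ ω, walkProd X f m N x ω ∂P ≤ 2 := by
  -- The supremum includes the starting time `m`, as the steps need not be identically distributed.
  set G : ℝ≥0∞ := ⨆ (m : ℕ) (j : ℕ) (_ : j ≤ N) (x : E), ∫⁻ ω, walkProd X f m j x ω ∂P with hG
  have hle : ∀ m j x, j ≤ N → ∫⁻ ω, walkProd X f m j x ω ∂P ≤ G := fun m j x hj =>
    le_iSup_of_le m <| le_iSup_of_le j <| le_iSup_of_le hj <|
      le_iSup (fun x => ∫⁻ ω, walkProd X f m j x ω ∂P) x
  have hfin : G ≤ (1 + B : ℝ≥0) ^ N := by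
    refine iSup_le fun m => iSup_le fun j => iSup_le fun hj => iSup_le fun x => ?_
    calc ∫⁻ ω, walkProd X f m j x ω ∂P ≤ ∫⁻ _, ((1 + B : ℝ≥0) : ℝ≥0∞) ^ N ∂P := by
          refine lintegral_mono fun ω => ?_
          calc walkProd X f m j x ω ≤ ∏ _i ∈ Finset.range j, ((1 + B : ℝ≥0) : ℝ≥0∞) := by
                refine Finset.prod_le_prod' fun i _ => ?_
                push_cast
                gcongr
                exact hB _
            _ ≤ _ := by
                rw [Finset.prod_const, Finset.card_range]
                refine pow_le_pow_right₀ ?_ hj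
                push_cast
                exact le_self_add
      _ = _ := by simp
  have hGt : G ≠ ∞ := (hfin.trans_lt (by simp)).ne
  -- Self-bounding inequality: since `G` is finite, by the crude bound from `hB`, it can be absorbed
  -- to give `G ≤ 2`.
  have hmain : G ≤ 1 + 1 / 2 * G := by
    refine iSup_le fun m => iSup_le fun j => iSup_le fun hj => iSup_le fun x => ?_
    have e : ∀ ω, walkProd X f m j x ω = 1 + ∑ k ∈ Finset.range j,
        f (x + ∑ l ∈ Finset.Ico m (m + k + 1), X l ω) *
        walkProd X f (m + k + 1) (j - (k + 1))
          (x + ∑ l ∈ Finset.Ico m (m + k + 1), X l ω) ω := by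
      intro ω
      rw [walkProd, prod_range_one_add]
      congr 1
      refine Finset.sum_congr rfl fun k _ => ?_
      congr 1
      refine Finset.prod_congr rfl fun i _ => ?_
      congr 2
      rw [add_assoc x, Finset.sum_Ico_consecutive _ (by omega) (by omega)]
      congr 3
      omega
    have hmeas : ∀ k, Measurable fun ω => f (x + ∑ l ∈ Finset.Ico m (m + k + 1), X l ω) *
        walkProd X f (m + k + 1) (j - (k + 1))
          (x + ∑ l ∈ Finset.Ico m (m + k + 1), X l ω) ω := by
      intro k
      have hs : Measurable fun ω => x + ∑ l ∈ Finset.Ico m (m + k + 1), X l ω :=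
        measurable_const.add (Finset.measurable_sum _ fun l _ => hX l)
      refine (hf.comp hs).mul ?_
      unfold walkProd
      exact Finset.measurable_prod _ fun i _ => measurable_const.add (hf.comp (hs.add
        (Finset.measurable_sum _ fun l _ => hX l)))
    simp_rw [e]
    rw [lintegral_add_left measurable_const, lintegral_finsetSum _ fun k _ => hmeas k]
    simp only [lintegral_const, measure_univ, mul_one]
    gcongr
    calc _ ≤ ∑ k ∈ Finset.range j,
          (∫⁻ ω, f (x + ∑ l ∈ Finset.Ico m (m + k + 1), X l ω) ∂P) * G :=
          Finset.sum_le_sum fun k _ => lintegral_mul_walkProd_le hX hi hf m k _ x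
            fun y => hle _ _ y (by omega)
      _ = (∑ k ∈ Finset.range j,
          ∫⁻ ω, f (x + ∑ l ∈ Finset.Ico m (m + k + 1), X l ω) ∂P) * G := by
          rw [Finset.sum_mul]
      _ ≤ 1 / 2 * G := by
          gcongr
          exact hα m j x hj
  refine (hle m N x le_rfl).trans ?_
  lift G to ℝ≥0 using hGt with g
  have h2 : ((1 : ℝ≥0∞) / 2) = ((1 / 2 : ℝ≥0) : ℝ≥0∞) := by
    rw [ENNReal.coe_div two_ne_zero]; simp
  rw [h2] at hmain
  have h3 : g ≤ 1 + 1 / 2 * g := by exact_mod_cast hmain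
  have h4 : g ≤ 2 := by
    rw [← NNReal.coe_le_coe] at h3 ⊢
    push_cast at h3 ⊢
    linarith
  exact_mod_cast h4

end Khasminskii

/-! ### The entropy inequality given the past. -/

theorem continuous_eval_path (t : ℝ) : Continuous fun ω : PathSpace => ω.1 t :=
  (ContinuousEvalConst.continuous_eval_const t).comp continuous_subtype_val

theorem measurable_eval_path (t : ℝ) : Measurable fun ω : PathSpace => ω.1 t :=
  (continuous_eval_path t).measurable

theorem pastAlgebra_le : pastAlgebra ≤ (inferInstance : MeasurableSpace PathSpace) :=
  iSup_le fun r => iSup_le fun s => iSup_le fun _ => Measurable.comap_le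
    ((measurable_eval_path s).sub (measurable_eval_path r))

/-- The entropy inequality, conditionally on the past. -/
theorem lintegral_diag_le_specificEntropy (Q P : ProbabilityMeasure PathSpace)
    (f : PathSpace → (PathSpace →ᵇ ℝ)) (hf0 : ∀ ω ω', 0 ≤ f ω ω')
    (hf1 : ∀ ω, Measurable[incrementAlgebra 0 1] (f ω : PathSpace → ℝ)) {K : ℝ}
    (hfP : ∀ ω, Real.log (∫ ω', Real.exp (f ω ω') ∂(P : Measure PathSpace)) ≤ K)
    (hf : Measurable[pastAlgebra.prod inferInstance]
      fun p : PathSpace × PathSpace => f p.1 p.2) :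
    ∫⁻ ω, ENNReal.ofReal (f ω ω) ∂(Q : Measure PathSpace)
      ≤ specificEntropy Q P + ENNReal.ofReal K := by
  have hF : Measurable[pastAlgebra.prod inferInstance]
      fun p : PathSpace × PathSpace => ENNReal.ofReal (f p.1 p.2) :=
    ENNReal.measurable_ofReal.comp hf
  have hdiag : @Measurable PathSpace (PathSpace × PathSpace) _ (pastAlgebra.prod inferInstance)
      Function.diag :=
    (measurable_id'' pastAlgebra_le).prodMk measurable_id
  have h1 : ∫⁻ ω, ENNReal.ofReal (f ω ω) ∂(Q : Measure PathSpace)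
      = ∫⁻ ω, ∫⁻ ω', ENNReal.ofReal (f ω ω')
          ∂(condExpKernel (Q : Measure PathSpace) pastAlgebra ω) ∂(Q : Measure PathSpace) := by
    -- Disintegration of the diagonal: with the past `σ`-algebra on the first factor, the law of
    -- `(ω, ω)` is the restriction of `Q` to the past composed with the conditional kernel.
    have h2 : ∫⁻ ω, ENNReal.ofReal (f ω ω) ∂(Q : Measure PathSpace)
        = @lintegral _ (pastAlgebra.prod inferInstance) (@Measure.map _ _ _
          (pastAlgebra.prod inferInstance) Function.diag (Q : Measure PathSpace))
          (fun p : PathSpace × PathSpace => ENNReal.ofReal (f p.1 p.2)) :=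
      (@lintegral_map _ _ _ (pastAlgebra.prod inferInstance) _ _ _ hF hdiag).symm
    rw [h2, ← compProd_trim_condExpKernel pastAlgebra_le, Measure.lintegral_compProd hF,
      lintegral_trim]
    exact hF.lintegral_kernel_prod_right'
  rw [h1]
  calc _ ≤ ∫⁻ ω, (relEntropyOn (condExpKernel (Q : Measure PathSpace) pastAlgebra ω)
          (P : Measure PathSpace) (incrementAlgebra 0 1) + ENNReal.ofReal K)
          ∂(Q : Measure PathSpace) := by
        refine lintegral_mono fun ω => ?_
        have hint : Integrable (f ω) (condExpKernel (Q : Measure PathSpace) pastAlgebra ω) :=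
          (f ω).integrable _
        rw [← ofReal_integral_eq_lintegral_ofReal hint (ae_of_all _ (hf0 ω))]
        calc ENNReal.ofReal (∫ ω', f ω ω' ∂(condExpKernel (Q : Measure PathSpace) pastAlgebra ω))
            ≤ ENNReal.ofReal (∫ ω', f ω ω' ∂(condExpKernel (Q : Measure PathSpace) pastAlgebra ω)
              - Real.log (∫ ω', Real.exp (f ω ω') ∂(P : Measure PathSpace)))
              + ENNReal.ofReal K := by
              rw [← sub_add_cancel
                (∫ ω', f ω ω' ∂(condExpKernel (Q : Measure PathSpace) pastAlgebra ω)) K]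
              refine ENNReal.ofReal_add_le.trans ?_
              rw [sub_add_cancel]
              gcongr
              exact hfP ω
          _ ≤ _ := by
              gcongr
              exact le_iSup₂_of_le (f ω) (hf1 ω) le_rfl
    _ = _ := by
        rw [lintegral_add_right _ measurable_const]
        simp [specificEntropy, entropyUpTo]

/-! ### Exponential moments under the Brownian law. -/

/-- Telescoping: with `a = j^(1/4)` and `b = (j+1)^(1/4)`, factoring `b^4 - a^4 = 1` gives `b^(-3) ≤
4 (b - a)`. -/
theorem sum_range_rpow_neg_le (j : ℕ) :
    ∑ k ∈ Finset.range j, ((k : ℝ) + 1) ^ (-(3 / 4) : ℝ) ≤ 4 * (j : ℝ) ^ (1 / 4 : ℝ) := by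
  induction j with
  | zero => simp
  | succ j ih =>
    rw [Finset.sum_range_succ]
    have hj : (0 : ℝ) ≤ j := j.cast_nonneg
    have hj1 : (0 : ℝ) < (j : ℝ) + 1 := by linarith
    push_cast
    set a := (j : ℝ) ^ (1 / 4 : ℝ) with ha
    set b := ((j : ℝ) + 1) ^ (1 / 4 : ℝ) with hb
    have ha0 : 0 ≤ a := Real.rpow_nonneg hj _
    have hb0 : 0 < b := Real.rpow_pos_of_pos hj1 _
    have hab : a ≤ b := Real.rpow_le_rpow hj (by linarith) (by norm_num)
    have ha4 : a ^ 4 = j := by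
      rw [ha, ← Real.rpow_natCast, ← Real.rpow_mul hj]; norm_num
    have hb4 : b ^ 4 = j + 1 := by
      rw [hb, ← Real.rpow_natCast, ← Real.rpow_mul hj1.le]; norm_num
    have hc : ((j : ℝ) + 1) ^ (-(3 / 4) : ℝ) = (b ^ 3)⁻¹ := by
      rw [hb, ← Real.rpow_natCast, ← Real.rpow_mul hj1.le, ← Real.rpow_neg hj1.le]; norm_num
    rw [hc]
    have h1 : 1 ≤ 4 * (b - a) * b ^ 3 := by
      have h2 : b ^ 4 - a ^ 4 = (b - a) * (b ^ 3 + b ^ 2 * a + b * a ^ 2 + a ^ 3) := by ring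
      have h3 : b ^ 3 + b ^ 2 * a + b * a ^ 2 + a ^ 3 ≤ 4 * b ^ 3 := by
        have i1 : b ^ 2 * a ≤ b ^ 2 * b := by gcongr
        have i2 : b * a ^ 2 ≤ b * b ^ 2 := by gcongr
        have i3 : a ^ 3 ≤ b ^ 3 := by gcongr
        nlinarith
      have h4 := mul_le_mul_of_nonneg_left h3 (sub_nonneg.2 hab)
      linarith
    have h5 : (b ^ 3)⁻¹ ≤ 4 * (b - a) := by
      rw [inv_le_iff_one_le_mul₀ (by positivity)]
      exact h1
    linarith

/-- Uniform exponential moments of weakly singular additive functionals of Brownian motion. -/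
theorem exists_log_integral_exp_le :
    ∃ c : ℝ≥0, ∀ P : ProbabilityMeasure PathSpace, IsBrownianIncrementLaw P →
      ∀ (g : E3 → ℝ) (G θ lam : ℝ) (N : ℕ), Measurable g → (∀ y, 0 ≤ g y) → (∀ y, g y ≤ G) →
        (∀ y, ENNReal.ofReal (g y) ≤ ENNReal.ofReal θ * ‖y‖ₑ ^ (-(3 / 2) : ℝ)) →
        0 ≤ θ → 0 < lam → 0 < N → lam * G ≤ N → 16 * lam * θ * c ≤ 1 → ∀ x : E3,
          Real.log (∫ ω : PathSpace,
            Real.exp (lam / N * ∑ k ∈ Finset.range N, g (x + ω.1 (k / N)))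
              ∂(P : Measure PathSpace)) ≤ 2 := by
  obtain ⟨c, hc⟩ := exists_lintegral_brownian_le
  refine ⟨c, fun P hP g G θ lam N hg hg0 hgG hgθ hθ hlam hN hNG hsmall x => ?_⟩
  have hN' : (0 : ℝ) < N := Nat.cast_pos.2 hN
  set X : ℕ → PathSpace → E3 := fun i ω => ω.1 ((i + 1 : ℕ) / N) - ω.1 (i / N) with hXdef
  have hX : ∀ i, Measurable (X i) := fun i =>
    (measurable_eval_path _).sub (measurable_eval_path _)
  have hmono : Monotone fun i : ℕ => (i : ℝ) / N := fun i j hij => by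
    have : (i : ℝ) ≤ j := Nat.cast_le.2 hij
    simp only
    gcongr
  have hi : iIndepFun X (P : Measure PathSpace) := hP.indep.nat hmono
  have hsum : ∀ (m n : ℕ) (ω : PathSpace), m ≤ n →
      ∑ l ∈ Finset.Ico m n, X l ω = ω.1 (n / N) - ω.1 (m / N) := by
    intro m n ω hmn
    rw [Finset.sum_Ico_eq_sub _ hmn]
    have := fun n => Finset.sum_range_sub (fun i : ℕ => ω.1 ((i : ℝ) / N)) n
    simp only [hXdef, this]
    abel
  -- This is the use of a fine grid: each exponent is at most 1, so that `exp u - 1 ≤ 2 u` applies.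
  have hG1 : ∀ y, lam / N * g y ≤ 1 := by
    intro y
    rw [div_mul_eq_mul_div, div_le_one hN']
    exact (mul_le_mul_of_nonneg_left (hgG y) hlam.le).trans hNG
  have hg1 : ∀ y, 0 ≤ lam / N * g y := fun y => mul_nonneg (by positivity) (hg0 y)
  set f : E3 → ℝ≥0∞ := fun y => ENNReal.ofReal (Real.exp (lam / N * g y) - 1) with hfdef
  have hf : Measurable f := by fun_prop
  have hexp : ∀ u : ℝ, 0 ≤ u → u ≤ 1 → Real.exp u - 1 ≤ 2 * u := by
    intro u h0 h1
    have := Real.abs_exp_sub_one_le (x := u) (by rwa [abs_of_nonneg h0])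
    rw [abs_of_nonneg h0] at this
    exact (le_abs_self _).trans this
  have hf1 : ∀ y, 1 + f y = ENNReal.ofReal (Real.exp (lam / N * g y)) := by
    intro y
    have := Real.one_le_exp (hg1 y)
    rw [hfdef, ← ENNReal.ofReal_one, ← ENNReal.ofReal_add zero_le_one (by linarith)]
    congr 1
    ring
  have hB : ∀ y, f y ≤ ((2 : ℝ≥0) : ℝ≥0∞) := by
    intro y
    refine ENNReal.ofReal_le_of_le_toReal ?_
    have := hexp _ (hg1 y) (hG1 y)
    have := hG1 y
    simp only [ENNReal.coe_toReal, NNReal.coe_ofNat]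
    linarith
  have hfθ : ∀ y, f y ≤ ENNReal.ofReal (2 * lam * θ / N) * ‖y‖ₑ ^ (-(3 / 2) : ℝ) := by
    intro y
    calc f y ≤ ENNReal.ofReal ((2 * lam / N) * g y) := by
          refine ENNReal.ofReal_le_ofReal ((hexp _ (hg1 y) (hG1 y)).trans (le_of_eq ?_))
          ring
      _ = ENNReal.ofReal (2 * lam / N) * ENNReal.ofReal (g y) :=
          ENNReal.ofReal_mul (by positivity)
      _ ≤ ENNReal.ofReal (2 * lam / N) * (ENNReal.ofReal θ * ‖y‖ₑ ^ (-(3 / 2) : ℝ)) := by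
          gcongr
          exact hgθ y
      _ = _ := by
          rw [← mul_assoc, ← ENNReal.ofReal_mul (by positivity)]
          congr 2
          ring
  -- The powers of `N` cancel, leaving `8 * lam * θ * c`; hence the constant 16 in the smallness
  -- condition.
  have hα : ∀ m j x, j ≤ N → ∑ k ∈ Finset.range j,
      ∫⁻ ω, f (x + ∑ l ∈ Finset.Ico m (m + k + 1), X l ω) ∂(P : Measure PathSpace) ≤ 1 / 2 := by
    intro m j x hj
    have hterm : ∀ k, ∫⁻ ω, f (x + ∑ l ∈ Finset.Ico m (m + k + 1), X l ω)
        ∂(P : Measure PathSpace) ≤ ENNReal.ofReal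
          (2 * lam * θ / N * c * N ^ (3 / 4 : ℝ) * ((k : ℝ) + 1) ^ (-(3 / 4) : ℝ)) := by
      intro k
      have hlt : (m : ℝ) / N < (m + k + 1 : ℕ) / N := by
        gcongr
        omega
      have hdiff : ((m + k + 1 : ℕ) : ℝ) / N - m / N = (k + 1) / N := by
        push_cast; ring
      have hpow : (((k : ℝ) + 1) / N) ^ (-(3 / 4) : ℝ)
          = N ^ (3 / 4 : ℝ) * ((k : ℝ) + 1) ^ (-(3 / 4) : ℝ) := by
        rw [Real.div_rpow (by positivity) hN'.le, Real.rpow_neg hN'.le, div_inv_eq_mul, mul_comm]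
      calc ∫⁻ ω, f (x + ∑ l ∈ Finset.Ico m (m + k + 1), X l ω) ∂(P : Measure PathSpace)
          ≤ ∫⁻ ω, ENNReal.ofReal (2 * lam * θ / N) *
            ‖x + (ω.1 ((m + k + 1 : ℕ) / N) - ω.1 (m / N))‖ₑ ^ (-(3 / 2) : ℝ)
              ∂(P : Measure PathSpace) := by
            refine lintegral_mono fun ω => ?_
            rw [hsum _ _ _ (by omega)]
            exact hfθ _
        _ ≤ ENNReal.ofReal (2 * lam * θ / N) *
            (c * ENNReal.ofReal ((((k : ℝ) + 1) / N) ^ (-(3 / 4) : ℝ))) := by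
            rw [lintegral_const_mul' _ _ ENNReal.ofReal_ne_top, ← hdiff]
            gcongr
            exact hc P hP _ _ hlt x
        _ = _ := by
            rw [hpow, ← ENNReal.ofReal_coe_nnreal, ← ENNReal.ofReal_mul c.coe_nonneg,
              ← ENNReal.ofReal_mul (by positivity)]
            congr 1
            ring
    calc _ ≤ ∑ k ∈ Finset.range j, ENNReal.ofReal
          (2 * lam * θ / N * c * N ^ (3 / 4 : ℝ) * ((k : ℝ) + 1) ^ (-(3 / 4) : ℝ)) :=
          Finset.sum_le_sum fun k _ => hterm k
      _ = ENNReal.ofReal (∑ k ∈ Finset.range j,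
          (2 * lam * θ / N * c * N ^ (3 / 4 : ℝ) * ((k : ℝ) + 1) ^ (-(3 / 4) : ℝ))) :=
          (ENNReal.ofReal_sum_of_nonneg fun k _ => by positivity).symm
      _ ≤ ENNReal.ofReal (1 / 2) := by
          refine ENNReal.ofReal_le_ofReal ?_
          rw [← Finset.mul_sum]
          have hjN : (j : ℝ) ^ (1 / 4 : ℝ) ≤ (N : ℝ) ^ (1 / 4 : ℝ) :=
            Real.rpow_le_rpow j.cast_nonneg (Nat.cast_le.2 hj) (by norm_num)
          have hNN : (N : ℝ) ^ (3 / 4 : ℝ) * (N : ℝ) ^ (1 / 4 : ℝ) = N := by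
            rw [← Real.rpow_add hN']; norm_num
          calc _ ≤ 2 * lam * θ / N * c * N ^ (3 / 4 : ℝ) * (4 * (N : ℝ) ^ (1 / 4 : ℝ)) := by
                gcongr
                exact (sum_range_rpow_neg_le j).trans (by gcongr)
            _ = 8 * lam * θ * c / N * (N ^ (3 / 4 : ℝ) * (N : ℝ) ^ (1 / 4 : ℝ)) := by ring
            _ = 8 * lam * θ * c := by rw [hNN]; field_simp
            _ ≤ 1 / 2 := by linarith
      _ = 1 / 2 := by
          rw [ENNReal.ofReal_div_of_pos two_pos]; simp
  have hmain := lintegral_walkProd_le_two (P := (P : Measure PathSpace)) hX hi hf hB N hα 0 x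
  have hle : ∀ ω : PathSpace,
      ENNReal.ofReal (Real.exp (lam / N * ∑ k ∈ Finset.range N, g (x + ω.1 (k / N))))
        ≤ ENNReal.ofReal (Real.exp 1) * walkProd X f 0 N x ω := by
    intro ω
    have hw : walkProd X f 0 N x ω = ENNReal.ofReal
        (Real.exp (∑ i ∈ Finset.range N, lam / N * g (x + ω.1 ((i + 1 : ℕ) / N)))) := by
      rw [Real.exp_sum, ENNReal.ofReal_prod_of_nonneg fun i _ => (Real.exp_pos _).le]
      refine Finset.prod_congr rfl fun i _ => ?_
      rw [hf1, hsum _ _ _ (by omega)]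
      simp [ω.2]
    rw [hw, ← ENNReal.ofReal_mul (Real.exp_pos _).le, ← Real.exp_add]
    refine ENNReal.ofReal_le_ofReal (Real.exp_le_exp.2 ?_)
    rw [Finset.mul_sum]
    -- The Riemann sum starts at time 0 and the walk product at time `1 / N`. The term at time 0
    -- costs a factor `exp 1`, whence the final bound `2 * exp 1 ≤ exp 2`.
    calc _ ≤ ∑ k ∈ Finset.range (N + 1), lam / N * g (x + ω.1 (k / N)) :=
          Finset.sum_le_sum_of_subset_of_nonneg
            (Finset.range_subset_range.2 (Nat.le_succ N)) fun i _ _ => hg1 _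
      _ ≤ _ := by
          rw [Finset.sum_range_succ', add_comm]
          gcongr
          exact hG1 _
  have hexp2 : 2 * Real.exp 1 ≤ Real.exp 2 := by
    have h1 : Real.exp 2 = Real.exp 1 * Real.exp 1 := by rw [← Real.exp_add]; norm_num
    have h2 := Real.add_one_le_exp (1 : ℝ)
    rw [h1]
    gcongr
    linarith
  have hint : ∫ ω : PathSpace, Real.exp (lam / N * ∑ k ∈ Finset.range N, g (x + ω.1 (k / N)))
      ∂(P : Measure PathSpace) ≤ Real.exp 2 := by
    have hm : Measurable fun ω : PathSpace =>
        Real.exp (lam / N * ∑ k ∈ Finset.range N, g (x + ω.1 (k / N))) :=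
      Real.measurable_exp.comp (measurable_const.mul (Finset.measurable_sum _ fun k _ =>
        hg.comp (measurable_const.add (measurable_eval_path _))))
    rw [integral_eq_lintegral_of_nonneg_ae (ae_of_all _ fun ω => (Real.exp_pos _).le)
      hm.aestronglyMeasurable]
    refine ENNReal.toReal_le_of_le_ofReal (Real.exp_pos _).le ?_
    calc _ ≤ ∫⁻ ω, ENNReal.ofReal (Real.exp 1) * walkProd X f 0 N x ω
            ∂(P : Measure PathSpace) := lintegral_mono hle
      _ ≤ ENNReal.ofReal (Real.exp 1) * 2 := by
          rw [lintegral_const_mul' _ _ ENNReal.ofReal_ne_top]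
          gcongr
      _ = ENNReal.ofReal (2 * Real.exp 1) := by
          rw [mul_comm, ENNReal.ofReal_mul zero_le_two]; simp
      _ ≤ _ := ENNReal.ofReal_le_ofReal hexp2
  have h0 : 0 ≤ ∫ ω : PathSpace,
      Real.exp (lam / N * ∑ k ∈ Finset.range N, g (x + ω.1 (k / N))) ∂(P : Measure PathSpace) :=
    integral_nonneg fun ω => (Real.exp_pos _).le
  rcases h0.eq_or_lt with h | h
  · rw [← h]; simp
  · exact (Real.log_le_iff_le_exp h).2 hint

/-! ### Stationarity and the entropy bound along a grid of times. -/

theorem measurable_increment {a b r s : ℝ} (har : a ≤ r) (hrs : r < s) (hsb : s ≤ b) :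
    Measurable[incrementAlgebra a b] fun ω : PathSpace => ω.1 s - ω.1 r :=
  measurable_iff_comap_le.2 <| le_iSup_of_le r <| le_iSup_of_le s <|
    le_iSup_of_le ⟨har, hrs, hsb⟩ le_rfl

theorem measurable_eval_incrementAlgebra {s : ℝ} (h0 : 0 ≤ s) (h1 : s ≤ 1) :
    Measurable[incrementAlgebra 0 1] fun ω : PathSpace => ω.1 s := by
  rcases h0.eq_or_lt with rfl | h
  · have : (fun ω : PathSpace => ω.1 0) = fun _ => 0 := funext fun ω => ω.2
    rw [this]
    exact measurable_const
  · have : (fun ω : PathSpace => ω.1 s) = fun ω => ω.1 s - ω.1 0 :=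
      funext fun ω => by rw [ω.2, sub_zero]
    rw [this]
    exact measurable_increment le_rfl h h1

theorem measurable_eval_pastAlgebra {r : ℝ} (hr : r ≤ 0) :
    Measurable[pastAlgebra] fun ω : PathSpace => ω.1 r := by
  rcases hr.eq_or_lt with rfl | h
  · have : (fun ω : PathSpace => ω.1 0) = fun _ => 0 := funext fun ω => ω.2
    rw [this]
    exact measurable_const
  · have : (fun ω : PathSpace => ω.1 r) = fun ω => -(ω.1 0 - ω.1 r) :=
      funext fun ω => by rw [ω.2, zero_sub, neg_neg]
    rw [this]
    refine Measurable.neg (measurable_iff_comap_le.2 ?_)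
    exact le_iSup_of_le r <| le_iSup_of_le 0 <| le_iSup_of_le ⟨h, le_rfl⟩ le_rfl

/-- The Riemann sum functional `ω ↦ c ∑_{k < N} g (x + ω (k / N))`. -/
noncomputable def riemannFunctional (g : E3 →ᵇ ℝ) (c : ℝ) (N : ℕ) (x : E3) : PathSpace →ᵇ ℝ :=
  BoundedContinuousFunction.ofNormedAddCommGroup
    (fun ω => c * ∑ k ∈ Finset.range N, g (x + ω.1 (k / N)))
    (continuous_const.mul (continuous_finsetSum _ fun k _ =>
      g.continuous.comp (continuous_const.add (continuous_eval_path _))))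
    (‖c‖ * ∑ _k ∈ Finset.range N, ‖g‖)
    (fun ω => by
      rw [norm_mul]
      gcongr
      exact norm_sum_le_of_le _ fun k _ => g.norm_coe_le_norm _)

theorem riemannFunctional_apply (g : E3 →ᵇ ℝ) (c : ℝ) (N : ℕ) (x : E3) (ω : PathSpace) :
    riemannFunctional g c N x ω = c * ∑ k ∈ Finset.range N, g (x + ω.1 (k / N)) := rfl

theorem measurable_riemannFunctional (g : E3 →ᵇ ℝ) (c : ℝ) (N : ℕ) (x : E3) :
    Measurable[incrementAlgebra 0 1] (riemannFunctional g c N x : PathSpace → ℝ) := by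
  refine Measurable.const_mul (Finset.measurable_sum _ fun k hk => ?_) c
  rw [Finset.mem_range] at hk
  have hN : (0 : ℝ) < N := Nat.cast_pos.2 (by omega)
  have hk1 : (k : ℝ) / N ≤ 1 := by
    rw [div_le_one hN]
    exact Nat.cast_le.2 hk.le
  exact g.continuous.measurable.comp (measurable_const.add
    (measurable_eval_incrementAlgebra (by positivity) hk1))

/-- The entropy bound at the times `a + k / N`. -/
theorem sum_lintegral_le_specificEntropy {Q : ProbabilityMeasure PathSpace}
    (hQ : Q ∈ StationaryIncrements) (P : ProbabilityMeasure PathSpace) (g : E3 →ᵇ ℝ)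
    (hg : ∀ y, 0 ≤ g y) {c K : ℝ} (hc : 0 ≤ c) {N : ℕ}
    (hP : ∀ x, Real.log (∫ ω, Real.exp (riemannFunctional g c N x ω)
      ∂(P : Measure PathSpace)) ≤ K) {a : ℝ} (ha : 0 ≤ a) :
    ∑ k ∈ Finset.range N, ENNReal.ofReal c *
        ∫⁻ ω : PathSpace, ENNReal.ofReal (g (ω.1 (a + k / N))) ∂(Q : Measure PathSpace)
      ≤ specificEntropy Q P + ENNReal.ofReal K := by
  have hmg : Measurable g := g.continuous.measurable
  have h1 := lintegral_diag_le_specificEntropy Q P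
    -- The starting point `-ω(-a)` is determined by the past. Under the shift by `a` it becomes
    -- `ω(a)`, which cancels the `-ω(a)` in the shifted path and leaves `ω(a + k / N)`.
    (fun ω => riemannFunctional g c N (-ω.1 (-a)))
    (fun ω ω' => mul_nonneg hc (Finset.sum_nonneg fun k _ => hg _))
    (fun ω => measurable_riemannFunctional g c N _) (fun ω => hP _)
    (by
      simp only [riemannFunctional_apply]
      refine Measurable.const_mul (Finset.measurable_sum _ fun k _ => hmg.comp ?_) c
      refine Measurable.add ?_ ?_
      · exact ((measurable_eval_pastAlgebra (neg_nonpos.2 ha)).comp measurable_fst).neg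
      · exact (measurable_eval_path _).comp measurable_snd)
  refine le_trans (le_of_eq ?_) h1
  have hm : Measurable fun ω : PathSpace =>
      ENNReal.ofReal (riemannFunctional g c N (-ω.1 (-a)) ω) := by
    simp only [riemannFunctional_apply]
    refine ENNReal.measurable_ofReal.comp
      (Measurable.const_mul (Finset.measurable_sum _ fun k _ => hmg.comp ?_) c)
    exact (measurable_eval_path _).neg.add (measurable_eval_path _)
  rw [← (hQ a).lintegral_comp hm]
  have e : ∀ ω : PathSpace,
      ENNReal.ofReal (riemannFunctional g c N (-(shift a ω).1 (-a)) (shift a ω))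
        = ∑ k ∈ Finset.range N,
          ENNReal.ofReal c * ENNReal.ofReal (g (ω.1 (a + k / N))) := by
    intro ω
    rw [riemannFunctional_apply, ENNReal.ofReal_mul hc,
      ENNReal.ofReal_sum_of_nonneg fun k _ => hg _, Finset.mul_sum]
    refine Finset.sum_congr rfl fun k _ => ?_
    congr 3
    have := ω.2
    simp only [shift, ContinuousMap.coe_mk, add_neg_cancel, this]
    abel
  simp_rw [e]
  have hmk : ∀ k : ℕ, Measurable fun ω : PathSpace => ENNReal.ofReal (g (ω.1 (a + k / N))) :=
    fun k => ENNReal.measurable_ofReal.comp (hmg.comp (measurable_eval_path _))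
  rw [lintegral_finsetSum _ fun k _ => (hmk k).const_mul _]
  refine Finset.sum_congr rfl fun k _ => ?_
  rw [lintegral_const_mul _ (hmk k)]

/-! ### From grids to exponentially weighted time averages. -/

theorem setLIntegral_Ioc_le_sum (ψ : ℝ → ℝ≥0∞) (a b : ℝ) (j : ℕ) :
    ∫⁻ t in Ioc a (a + j * b), ψ t
      ≤ ∑ k ∈ Finset.range j, ∫⁻ u in Ioc a (a + b), ψ (u + k * b) := by
  induction j with
  | zero => simp
  | succ j ih =>
    have hsub : Ioc a (a + (j + 1 : ℕ) * b)
        ⊆ Ioc a (a + j * b) ∪ Ioc (a + j * b) (a + (j + 1 : ℕ) * b) := Ioc_subset_Ioc_union_Ioc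
    have htr : ∫⁻ t in Ioc (a + j * b) (a + (j + 1 : ℕ) * b), ψ t
        = ∫⁻ u in Ioc a (a + b), ψ (u + j * b) := by
      rw [← (measurePreserving_add_right volume ((j : ℝ) * b)).setLIntegral_comp_preimage_emb
        (MeasurableEquiv.addRight _).measurableEmbedding, preimage_add_const_Ioc]
      congr 3
      · ring
      · push_cast; ring
    rw [Finset.sum_range_succ, ← htr]
    exact (lintegral_mono_set hsub).trans ((lintegral_union_le _ _ _).trans (by gcongr))

/-- On the `n`-th unit interval the weight is at most `exp(-ε)^n`. The geometric series sums to `1 /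
(1 - exp(-ε))`, which is at most `2 / ε` for `ε ≤ 1`. -/
theorem mul_lintegral_exp_le {φ : ℝ → ℝ≥0∞} {D : ℝ≥0∞}
    (h : ∀ n : ℕ, ∫⁻ t in Ioc (n : ℝ) (n + 1), φ t ≤ D) {ε : ℝ} (hε : 0 < ε) (hε1 : ε ≤ 1) :
    ENNReal.ofReal ε * ∫⁻ t in Ioi (0 : ℝ), ENNReal.ofReal (Real.exp (-ε * t)) * φ t
      ≤ 2 * D := by
  have hsub : Ioi (0 : ℝ) ⊆ ⋃ n : ℕ, Ioc (n : ℝ) (n + 1) := by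
    intro t ht
    have ht0 : 0 < ⌈t⌉₊ := Nat.ceil_pos.2 ht
    refine mem_iUnion.2 ⟨⌈t⌉₊ - 1, ?_, ?_⟩
    · exact Nat.lt_ceil.1 (by omega)
    · have := Nat.le_ceil t
      rwa [Nat.cast_sub (by omega), Nat.cast_one, sub_add_cancel]
  set r : ℝ := Real.exp (-ε) with hr
  have hr0 : 0 < r := Real.exp_pos _
  have hr1 : ε / 2 ≤ 1 - r := by
    have h1 := Real.add_one_le_exp ε
    have h2 : r * Real.exp ε = 1 := by rw [hr, ← Real.exp_add]; simp
    nlinarith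
  have hn : ∀ n : ℕ, ∫⁻ t in Ioc (n : ℝ) (n + 1), ENNReal.ofReal (Real.exp (-ε * t)) * φ t
      ≤ ENNReal.ofReal r ^ n * D := by
    intro n
    calc _ ≤ ∫⁻ t in Ioc (n : ℝ) (n + 1), ENNReal.ofReal r ^ n * φ t := by
          refine setLIntegral_mono' measurableSet_Ioc fun t ht => ?_
          gcongr
          rw [← ENNReal.ofReal_pow hr0.le, hr, ← Real.exp_nat_mul]
          refine ENNReal.ofReal_le_ofReal (Real.exp_le_exp.2 ?_)
          nlinarith [ht.1]
      _ = ENNReal.ofReal r ^ n * ∫⁻ t in Ioc (n : ℝ) (n + 1), φ t :=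
          lintegral_const_mul' _ _ (by finiteness)
      _ ≤ _ := by gcongr; exact h n
  have hε2 : ENNReal.ofReal ε = 2 * ENNReal.ofReal (ε / 2) := by
    rw [← ENNReal.ofReal_ofNat 2, ← ENNReal.ofReal_mul zero_le_two]
    congr 1
    ring
  have hpos : ENNReal.ofReal (ε / 2) ≠ 0 := by
    rw [Ne, ENNReal.ofReal_eq_zero]; linarith
  calc _ ≤ ENNReal.ofReal ε * ∑' n : ℕ, ENNReal.ofReal r ^ n * D := by
        gcongr
        refine (lintegral_mono_set hsub).trans ((lintegral_iUnion_le _ _).trans ?_)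
        exact ENNReal.tsum_le_tsum hn
    _ = ENNReal.ofReal ε * ((1 - ENNReal.ofReal r)⁻¹ * D) := by
        rw [ENNReal.tsum_mul_right, ENNReal.tsum_geometric]
    _ ≤ 2 * ENNReal.ofReal (ε / 2) * ((ENNReal.ofReal (ε / 2))⁻¹ * D) := by
        rw [hε2]
        gcongr
        rw [← ENNReal.ofReal_one, ← ENNReal.ofReal_sub _ hr0.le]
        exact ENNReal.ofReal_le_ofReal hr1
    _ = 2 * D := by
        rw [mul_assoc, ← mul_assoc (ENNReal.ofReal (ε / 2)),
          ENNReal.mul_inv_cancel hpos ENNReal.ofReal_ne_top, one_mul]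

theorem measurable_eval_uncurry : Measurable fun p : PathSpace × ℝ => p.1.1 p.2 :=
  (by fun_prop : Continuous fun p : PathSpace × ℝ => p.1.1 p.2).measurable

theorem averaged_eq_lintegral_prod (ε : ℝ) {W : E3 → ℝ≥0∞} (hW : Measurable W)
    (Q : ProbabilityMeasure PathSpace) :
    averaged ε W Q = ENNReal.ofReal ε *
      ∫⁻ p : PathSpace × ℝ, ENNReal.ofReal (Real.exp (-ε * p.2)) * W (p.1.1 p.2)
        ∂((Q : Measure PathSpace).prod (volume.restrict (Ioi 0))) := by
  have hm : Measurable fun p : PathSpace × ℝ =>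
      ENNReal.ofReal (Real.exp (-ε * p.2)) * W (p.1.1 p.2) :=
    (by fun_prop : Measurable fun p : PathSpace × ℝ =>
      ENNReal.ofReal (Real.exp (-ε * p.2))).mul (hW.comp measurable_eval_uncurry)
  rw [averaged, lintegral_const_mul' _ _ ENNReal.ofReal_ne_top, lintegral_prod _ hm.aemeasurable]
  congr 1
  refine lintegral_congr fun ω => lintegral_congr fun t => ?_
  rw [ω.2, sub_zero]

theorem averaged_eq_lintegral_lintegral (ε : ℝ) {W : E3 → ℝ≥0∞} (hW : Measurable W)
    (Q : ProbabilityMeasure PathSpace) :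
    averaged ε W Q = ENNReal.ofReal ε *
      ∫⁻ t in Ioi (0 : ℝ), ENNReal.ofReal (Real.exp (-ε * t)) *
        ∫⁻ ω : PathSpace, W (ω.1 t) ∂(Q : Measure PathSpace) := by
  have hm : Measurable fun p : PathSpace × ℝ =>
      ENNReal.ofReal (Real.exp (-ε * p.2)) * W (p.1.1 p.2) :=
    (by fun_prop : Measurable fun p : PathSpace × ℝ =>
      ENNReal.ofReal (Real.exp (-ε * p.2))).mul (hW.comp measurable_eval_uncurry)
  rw [averaged_eq_lintegral_prod ε hW, lintegral_prod_symm' _ hm]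
  congr 1
  exact lintegral_congr fun t => lintegral_const_mul' (ENNReal.ofReal (Real.exp (-ε * t)))
    (fun ω : PathSpace => W (ω.1 t)) ENNReal.ofReal_ne_top

/-- The grid bound holds for every offset `u` in `(n, n + 1/N]`; integrating it over `u` covers the
whole unit interval, so no discretisation error arises. -/
theorem averaged_le_of_exp_bound {Q : ProbabilityMeasure PathSpace}
    (hQ : Q ∈ StationaryIncrements) (P : ProbabilityMeasure PathSpace) (g : E3 →ᵇ ℝ)
    (hg : ∀ y, 0 ≤ g y) {lam K : ℝ} (hlam : 0 < lam) {N : ℕ} (hN : 0 < N)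
    (hP : ∀ x, Real.log (∫ ω, Real.exp (riemannFunctional g (lam / N) N x ω)
      ∂(P : Measure PathSpace)) ≤ K) {ε : ℝ} (hε : 0 < ε) (hε1 : ε ≤ 1) :
    averaged ε (fun y => ENNReal.ofReal (g y)) Q
      ≤ 2 * ((specificEntropy Q P + ENNReal.ofReal K) / ENNReal.ofReal lam) := by
  have hN' : (0 : ℝ) < N := Nat.cast_pos.2 hN
  have hW : Measurable fun y => ENNReal.ofReal (g y) :=
    ENNReal.measurable_ofReal.comp g.continuous.measurable
  rw [averaged_eq_lintegral_lintegral ε hW]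
  refine mul_lintegral_exp_le (fun n => ?_) hε hε1
  set φ : ℝ → ℝ≥0∞ := fun t =>
    ∫⁻ ω : PathSpace, ENNReal.ofReal (g (ω.1 t)) ∂(Q : Measure PathSpace) with hφ
  have hφm : Measurable φ :=
    (hW.comp (measurable_eval_uncurry.comp measurable_swap)).lintegral_prod_right'
  set A := specificEntropy Q P + ENNReal.ofReal K
  have hlam0 : ENNReal.ofReal lam ≠ 0 := by simpa using hlam
  rw [ENNReal.le_div_iff_mul_le (Or.inl hlam0) (Or.inl ENNReal.ofReal_ne_top), mul_comm]
  have hlamN : ENNReal.ofReal lam = ENNReal.ofReal N * ENNReal.ofReal (lam / N) := by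
    rw [← ENNReal.ofReal_mul hN'.le]
    congr 1
    field_simp
  have hone : (n : ℝ) + 1 = n + N * (1 / N : ℝ) := by field_simp
  have hmk : ∀ k : ℕ, Measurable fun u : ℝ => φ (u + k * (1 / N : ℝ)) := fun k =>
    hφm.comp (by fun_prop)
  calc ENNReal.ofReal lam * ∫⁻ t in Ioc (n : ℝ) (n + 1), φ t
      ≤ ENNReal.ofReal lam * ∑ k ∈ Finset.range N,
          ∫⁻ u in Ioc (n : ℝ) (n + 1 / N), φ (u + k * (1 / N : ℝ)) := by
        gcongr
        rw [hone]
        exact setLIntegral_Ioc_le_sum φ n _ N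
    _ = ENNReal.ofReal N * ∫⁻ u in Ioc (n : ℝ) (n + 1 / N),
          ∑ k ∈ Finset.range N, ENNReal.ofReal (lam / N) * φ (u + k * (1 / N : ℝ)) := by
        rw [lintegral_finsetSum _ fun k _ => (hmk k).const_mul _, hlamN, mul_assoc,
          Finset.mul_sum]
        simp_rw [lintegral_const_mul _ (hmk _)]
    _ ≤ ENNReal.ofReal N * ∫⁻ _ in Ioc (n : ℝ) (n + 1 / N), A := by
        refine mul_le_mul' le_rfl (setLIntegral_mono' measurableSet_Ioc fun u hu => ?_)
        have hu0 : 0 ≤ u := le_trans n.cast_nonneg hu.1.le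
        have := sum_lintegral_le_specificEntropy hQ P g hg (by positivity) hP hu0
        simpa only [hφ, mul_one_div] using this
    _ = A := by
        rw [setLIntegral_const, Real.volume_Ioc, add_sub_cancel_left, mul_comm A, ← mul_assoc,
          ← ENNReal.ofReal_mul hN'.le, mul_one_div_cancel hN'.ne', ENNReal.ofReal_one, one_mul]

/-- Fatou's lemma on the product of path space and time. -/
theorem averaged_le_of_tendsto {ε : ℝ} {W : E3 → ℝ≥0∞} {w : ℕ → E3 → ℝ≥0∞}
    (hW : Measurable W) (hw : ∀ n, Measurable (w n))
    (hlim : ∀ y, Tendsto (fun n => w n y) atTop (𝓝 (W y))) {Q : ProbabilityMeasure PathSpace}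
    {B : ℝ≥0∞} (hB : ∀ n, averaged ε (w n) Q ≤ B) : averaged ε W Q ≤ B := by
  rw [averaged_eq_lintegral_prod ε hW, ← lintegral_const_mul' _ _ ENNReal.ofReal_ne_top]
  have hm : ∀ n, Measurable fun p : PathSpace × ℝ =>
      ENNReal.ofReal ε * (ENNReal.ofReal (Real.exp (-ε * p.2)) * w n (p.1.1 p.2)) := fun n =>
    ((by fun_prop : Measurable fun p : PathSpace × ℝ =>
      ENNReal.ofReal (Real.exp (-ε * p.2))).mul ((hw n).comp measurable_eval_uncurry)).const_mul _
  calc _ = ∫⁻ p : PathSpace × ℝ, liminf (fun n =>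
          ENNReal.ofReal ε * (ENNReal.ofReal (Real.exp (-ε * p.2)) * w n (p.1.1 p.2))) atTop
          ∂((Q : Measure PathSpace).prod (volume.restrict (Ioi 0))) := by
        refine lintegral_congr fun p => Eq.symm ?_
        refine Tendsto.liminf_eq ?_
        exact ENNReal.Tendsto.const_mul (ENNReal.Tendsto.const_mul (hlim _)
          (Or.inr ENNReal.ofReal_ne_top)) (Or.inr ENNReal.ofReal_ne_top)
    _ ≤ liminf (fun n => ∫⁻ p : PathSpace × ℝ,
          ENNReal.ofReal ε * (ENNReal.ofReal (Real.exp (-ε * p.2)) * w n (p.1.1 p.2))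
          ∂((Q : Measure PathSpace).prod (volume.restrict (Ioi 0)))) atTop :=
        lintegral_liminf_le hm
    _ ≤ B := by
        refine liminf_le_of_frequently_le' (Frequently.of_forall fun n => ?_)
        rw [lintegral_const_mul' _ _ ENNReal.ofReal_ne_top, ← averaged_eq_lintegral_prod ε (hw n)]
        exact hB n

/-! ### The singular part of the Coulomb potential and its truncation. -/

theorem measurable_coulomb : Measurable coulomb := by
  unfold coulomb
  fun_prop

theorem measurable_coulombReg (η : ℝ) : Measurable (coulombReg η) := by
  unfold coulombReg
  fun_prop

theorem measurable_coulombSing (η : ℝ) : Measurable (coulombSing η) :=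
  measurable_coulomb.sub (measurable_coulombReg η)

theorem sqrt_sq_add_sq_pos {η : ℝ} (hη : 0 < η) (y : E3) : 0 < √(η ^ 2 + ‖y‖ ^ 2) :=
  Real.sqrt_pos.2 (by positivity)

theorem le_sqrt_sq_add_sq (η : ℝ) (y : E3) : η ≤ √(η ^ 2 + ‖y‖ ^ 2) :=
  Real.le_sqrt_of_sq_le (by nlinarith [sq_nonneg ‖y‖])

theorem coulombReg_le {η : ℝ} (hη : 0 < η) (y : E3) : coulombReg η y ≤ ENNReal.ofReal (1 / η) :=
  ENNReal.ofReal_le_ofReal (one_div_le_one_div_of_le hη (le_sqrt_sq_add_sq η y))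

/-- The truncated singular part `(V_σ - V_η)⁺`, as a bounded continuous function. -/
noncomputable def truncSing {σ η : ℝ} (hσ : 0 < σ) (hη : 0 < η) : E3 →ᵇ ℝ :=
  BoundedContinuousFunction.ofNormedAddCommGroup
    (fun y => max (1 / √(σ ^ 2 + ‖y‖ ^ 2) - 1 / √(η ^ 2 + ‖y‖ ^ 2)) 0)
    (by
      have h1 := fun y => (sqrt_sq_add_sq_pos hσ y).ne'
      have h2 := fun y => (sqrt_sq_add_sq_pos hη y).ne'
      fun_prop (disch := assumption))
    (1 / σ)
    (fun y => by
      rw [Real.norm_of_nonneg (le_max_right _ _)]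
      refine max_le ?_ (by positivity)
      have h1 := one_div_le_one_div_of_le hσ (le_sqrt_sq_add_sq σ y)
      have h2 : 0 ≤ 1 / √(η ^ 2 + ‖y‖ ^ 2) := by positivity
      linarith)

section

variable {σ η : ℝ} (hσ : 0 < σ) (hη : 0 < η)

theorem truncSing_apply (y : E3) : truncSing hσ hη y
    = max (1 / √(σ ^ 2 + ‖y‖ ^ 2) - 1 / √(η ^ 2 + ‖y‖ ^ 2)) 0 := rfl

theorem truncSing_nonneg (y : E3) : 0 ≤ truncSing hσ hη y := le_max_right _ _

theorem truncSing_le (y : E3) : truncSing hσ hη y ≤ 1 / σ := by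
  rw [truncSing_apply]
  refine max_le ?_ (by positivity)
  have h1 := one_div_le_one_div_of_le hσ (le_sqrt_sq_add_sq σ y)
  have h2 : 0 ≤ 1 / √(η ^ 2 + ‖y‖ ^ 2) := by positivity
  linarith

theorem ofReal_truncSing (y : E3) :
    ENNReal.ofReal (truncSing hσ hη y) = coulombReg σ y - coulombReg η y := by
  rw [truncSing_apply, ENNReal.ofReal_max, ENNReal.ofReal_zero, max_eq_left zero_le,
    ENNReal.ofReal_sub _ (by positivity), coulombReg, coulombReg]

/-- Put `r = |y|` and `R = √(η² + r²)`. Then `1/r - 1/R = η² / (r R (R + r))`, and `R ≥ η` with `R ≥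
√(η r)` gives `R (R + r) ≥ η^(3/2) r^(1/2)`. The bound does not involve `σ`. -/
theorem ofReal_truncSing_le (y : E3) : ENNReal.ofReal (truncSing hσ hη y)
    ≤ ENNReal.ofReal √η * ‖y‖ₑ ^ (-(3 / 2) : ℝ) := by
  rcases eq_or_ne y 0 with rfl | hy
  · have : ENNReal.ofReal √η ≠ 0 := by simpa using hη
    rw [enorm_zero, ENNReal.zero_rpow_of_neg (by norm_num), ENNReal.mul_top this]
    exact le_top
  · have hr : 0 < ‖y‖ := norm_pos_iff.2 hy
    rw [← ofReal_norm, ENNReal.ofReal_rpow_of_pos hr,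
      ← ENNReal.ofReal_mul (Real.sqrt_nonneg _)]
    refine ENNReal.ofReal_le_ofReal ?_
    rw [truncSing_apply]
    refine max_le ?_ (by positivity)
    set r := ‖y‖
    have h1 : 1 / √(σ ^ 2 + r ^ 2) ≤ 1 / r :=
      one_div_le_one_div_of_le hr (Real.le_sqrt_of_sq_le (by nlinarith [sq_nonneg σ]))
    set R := √(η ^ 2 + r ^ 2) with hR
    have hR2 : R ^ 2 = η ^ 2 + r ^ 2 := Real.sq_sqrt (by positivity)
    have hRr : r ≤ R := Real.le_sqrt_of_sq_le (by nlinarith [sq_nonneg η])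
    have hRη : η ≤ R := le_sqrt_sq_add_sq η y
    have hR0 : 0 < R := hr.trans_le hRr
    set a := √η with ha
    set b := √r with hb
    have ha0 : 0 < a := Real.sqrt_pos.2 hη
    have hb0 : 0 < b := Real.sqrt_pos.2 hr
    have ha2 : a ^ 2 = η := Real.sq_sqrt hη.le
    have hb2 : b ^ 2 = r := Real.sq_sqrt hr.le
    have hpow : r ^ (-(3 / 2) : ℝ) = (b ^ 3)⁻¹ := by
      rw [hb, Real.sqrt_eq_rpow, ← Real.rpow_natCast, ← Real.rpow_mul hr.le,
        ← Real.rpow_neg hr.le]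
      norm_num
    have hdiff : 1 / r - 1 / R = η ^ 2 / (r * (R * (R + r))) := by
      field_simp
      nlinarith
    have key : a ^ 3 * b ≤ R * (R + r) := by
      have h3 : a * b ≤ R := by
        have := Real.sqrt_le_sqrt (mul_le_mul hRη hRr hr.le hR0.le)
        rwa [Real.sqrt_mul hη.le, Real.sqrt_mul_self hR0.le] at this
      calc a ^ 3 * b = η * (a * b) := by rw [← ha2]; ring
        _ ≤ R * R := by gcongr
        _ ≤ _ := by gcongr; linarith
    have hfin : η ^ 2 / (r * (R * (R + r))) ≤ a * (b ^ 3)⁻¹ := by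
      rw [← div_eq_mul_inv, div_le_div_iff₀ (by positivity) (by positivity)]
      calc η ^ 2 * b ^ 3 = a * r * (a ^ 3 * b) := by rw [← ha2, ← hb2]; ring
        _ ≤ a * r * (R * (R + r)) := by gcongr
        _ = _ := by ring
    rw [hpow]
    linarith

end

theorem tendsto_coulombReg (y : E3) :
    Tendsto (fun n : ℕ => coulombReg (1 / ((n : ℝ) + 1)) y) atTop (𝓝 (coulomb y)) := by
  have h : ∀ n : ℕ, coulombReg (1 / ((n : ℝ) + 1)) y
      = (ENNReal.ofReal √((1 / ((n : ℝ) + 1)) ^ 2 + ‖y‖ ^ 2))⁻¹ := by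
    intro n
    rw [coulombReg, one_div, ENNReal.ofReal_inv_of_pos (sqrt_sq_add_sq_pos (by positivity) y)]
  simp_rw [h]
  -- Inversion is continuous on `ℝ≥0∞`, so the case `y = 0`, with limit `∞`, needs no separate
  -- treatment.
  refine tendsto_inv_iff.2 ((ENNReal.continuous_ofReal.tendsto _).comp ?_)
  have h2 := ((tendsto_one_div_add_atTop_nhds_zero_nat (𝕜 := ℝ)).pow 2).add_const (‖y‖ ^ 2)
  have h3 := (Real.continuous_sqrt.tendsto _).comp h2
  simpa [Function.comp_def] using h3

/-- The averaged singular part is bounded by the entropy, with a constant that is as small as we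
wish if the regularisation parameter is small. -/
theorem exists_averaged_coulombSing_le :
    ∃ c : ℝ≥0, ∀ P : ProbabilityMeasure PathSpace, IsBrownianIncrementLaw P →
      ∀ η lam : ℝ, 0 < η → 0 < lam → 16 * lam * √η * c ≤ 1 →
        ∀ Q ∈ StationaryIncrements, ∀ ε : ℝ, 0 < ε → ε ≤ 1 →
          averaged ε (coulombSing η) Q
            ≤ 2 * ((specificEntropy Q P + ENNReal.ofReal 2) / ENNReal.ofReal lam) := by
  obtain ⟨c, hc⟩ := exists_log_integral_exp_le
  refine ⟨c, fun P hP η lam hη hlam hsmall Q hQ ε hε hε1 => ?_⟩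
  have hσ : ∀ n : ℕ, (0 : ℝ) < 1 / ((n : ℝ) + 1) := fun n => by positivity
  refine averaged_le_of_tendsto (w := fun n y => coulombReg (1 / ((n : ℝ) + 1)) y - coulombReg η y)
    (measurable_coulombSing η)
    (fun n => (measurable_coulombReg _).sub (measurable_coulombReg η)) (fun y => ?_) fun n => ?_
  · exact ENNReal.Tendsto.sub (tendsto_coulombReg y) tendsto_const_nhds
      (Or.inr ENNReal.ofReal_ne_top)
  · simp_rw [← ofReal_truncSing (hσ n) hη]
    -- The mesh depends on the truncation level `σ = 1 / (n + 1)`, but the resulting bound does not.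
    obtain ⟨N, hN⟩ := exists_nat_ge (lam * (1 / (1 / ((n : ℝ) + 1))))
    have hN0 : 0 < N := by
      rw [← Nat.cast_pos (α := ℝ)]
      exact lt_of_lt_of_le (by positivity) hN
    refine averaged_le_of_exp_bound hQ P _ (truncSing_nonneg (hσ n) hη) hlam hN0 (fun x => ?_)
      hε hε1
    exact hc P hP _ _ √η lam N (truncSing (hσ n) hη).continuous.measurable
      (truncSing_nonneg _ _) (truncSing_le _ _) (ofReal_truncSing_le _ _)
      (Real.sqrt_nonneg _) hlam hN0 hN hsmall x

/-! ### The regular part and the choice of constants. -/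

theorem averaged_coulombReg_le {η ε : ℝ} (hη : 0 < η) (hε : 0 < ε) (hε1 : ε ≤ 1)
    (Q : ProbabilityMeasure PathSpace) :
    averaged ε (coulombReg η) Q ≤ 2 * ENNReal.ofReal (1 / η) := by
  rw [averaged_eq_lintegral_lintegral ε (measurable_coulombReg η)]
  refine mul_lintegral_exp_le (fun n => ?_) hε hε1
  calc _ ≤ ∫⁻ _ in Ioc (n : ℝ) (n + 1), ENNReal.ofReal (1 / η) := by
        refine lintegral_mono fun t => ?_
        calc _ ≤ ∫⁻ _ : PathSpace, ENNReal.ofReal (1 / η) ∂(Q : Measure PathSpace) :=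
              lintegral_mono fun ω => coulombReg_le hη _
          _ = _ := by simp
    _ = _ := by simp

theorem averaged_coulomb_le (η ε : ℝ) (Q : ProbabilityMeasure PathSpace) :
    averaged ε coulomb Q ≤ averaged ε (coulombReg η) Q + averaged ε (coulombSing η) Q := by
  have hm : Measurable fun p : PathSpace × ℝ =>
      ENNReal.ofReal (Real.exp (-ε * p.2)) * coulombReg η (p.1.1 p.2) :=
    (by fun_prop : Measurable fun p : PathSpace × ℝ =>
      ENNReal.ofReal (Real.exp (-ε * p.2))).mul
      ((measurable_coulombReg η).comp measurable_eval_uncurry)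
  rw [averaged_eq_lintegral_prod ε measurable_coulomb,
    averaged_eq_lintegral_prod ε (measurable_coulombReg η),
    averaged_eq_lintegral_prod ε (measurable_coulombSing η), ← mul_add, ← lintegral_add_left hm]
  gcongr with p
  rw [← mul_add]
  gcongr
  exact le_add_tsub

/-- A regularisation parameter that is small enough for a given exponential rate. -/
theorem exists_sqrt_small (c : ℝ≥0) {lam : ℝ} (hlam : 0 < lam) :
    ∃ η₀ : ℝ, 0 < η₀ ∧ ∀ η, η ≤ η₀ → 16 * lam * √η * c ≤ 1 := by
  -- `c + 1` instead of `c` keeps the denominator positive when `c = 0`.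
  set s : ℝ := 1 / (16 * lam * (c + 1)) with hs
  have hs0 : 0 < s := by positivity
  refine ⟨s ^ 2, by positivity, fun η hη => ?_⟩
  have h1 : √η ≤ s := (Real.sqrt_le_sqrt hη).trans_eq (Real.sqrt_sq hs0.le)
  calc 16 * lam * √η * c ≤ 16 * lam * s * (c + 1) := by gcongr; linarith
    _ = 1 := by rw [hs]; field_simp

end Polaron

theorem mainTheorem7 (P : ProbabilityMeasure Polaron.PathSpace)
    (hP : Polaron.IsBrownianIncrementLaw P) :
    (∀ C : ℝ≥0,
      Tendsto
        (fun η : ℝ =>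
          ⨆ (Q : ProbabilityMeasure Polaron.PathSpace) (_ : Q ∈ Polaron.StationaryIncrements)
            (_ : Polaron.specificEntropy Q P ≤ (C : ℝ≥0∞)) (ε : ℝ) (_ : 0 < ε ∧ ε ≤ 1),
            Polaron.averaged ε (Polaron.coulombSing η) Q)
        (𝓝[>] 0) (𝓝 0)) ∧
    (∀ δ : ℝ, 0 < δ → ∃ K : ℝ≥0, ∀ ε : ℝ, 0 < ε → ε ≤ 1 →
      ∀ Q : ProbabilityMeasure Polaron.PathSpace, Q ∈ Polaron.StationaryIncrements →
        Polaron.specificEntropy Q P < ∞ →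
        Polaron.averaged ε Polaron.coulomb Q
          ≤ ENNReal.ofReal δ * Polaron.specificEntropy Q P + (K : ℝ≥0∞)) := by
  obtain ⟨c, hc⟩ := Polaron.exists_averaged_coulombSing_le
  -- The rate `lam = 2 / e` makes the coefficient of the entropy in the main estimate exactly `e`.
  have hdiv : ∀ {e : ℝ} (A : ℝ≥0∞), 0 < e →
      2 * (A / ENNReal.ofReal (2 / e)) = ENNReal.ofReal e * A := by
    intro e A he
    rw [ENNReal.ofReal_div_of_pos he, ENNReal.ofReal_ofNat, div_eq_mul_inv,
      ENNReal.inv_div (Or.inr (by simp)) (Or.inr (by simp)), div_eq_mul_inv,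
      mul_comm A, mul_comm (ENNReal.ofReal e), mul_assoc, ← mul_assoc,
      ENNReal.mul_inv_cancel two_ne_zero (by simp), one_mul]
  constructor
  · intro C
    rw [ENNReal.tendsto_nhds_zero]
    intro e he
    obtain ⟨e', he', hee⟩ : ∃ e' : ℝ, 0 < e' ∧ ENNReal.ofReal e' * (C + 2) ≤ e := by
      obtain ⟨r, hr0, hr⟩ := ENNReal.lt_iff_exists_nnreal_btwn.1 he
      have hr0' : 0 < r := by exact_mod_cast hr0
      refine ⟨r / (C + 2), by positivity, ?_⟩
      have h2 : (C : ℝ≥0∞) + 2 = ENNReal.ofReal ((C : ℝ) + 2) := by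
        rw [ENNReal.ofReal_add C.coe_nonneg zero_le_two]; simp
      rw [h2, ← ENNReal.ofReal_mul (by positivity), div_mul_cancel₀ _ (by positivity)]
      simpa using hr.le
    have hlam : 0 < 2 / e' := by positivity
    obtain ⟨η₀, hη₀, hsmall⟩ := Polaron.exists_sqrt_small c hlam
    filter_upwards [Ioc_mem_nhdsGT hη₀] with η hη
    refine iSup_le fun Q => iSup_le fun hQ => iSup_le fun hH => iSup_le fun ε =>
      iSup_le fun hε => ?_
    refine (hc P hP η _ hη.1 hlam (hsmall η hη.2) Q hQ ε hε.1 hε.2).trans ?_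
    rw [hdiv _ he']
    refine le_trans ?_ hee
    rw [ENNReal.ofReal_ofNat]
    gcongr
  · intro δ hδ
    have hlam : 0 < 2 / δ := by positivity
    obtain ⟨η, hη, hsmall⟩ := Polaron.exists_sqrt_small c hlam
    -- The term `2 δ` comes from the log-moment bound 2, and `2 / η` from the regular part.
    refine ⟨Real.toNNReal δ * 2 + 2 * Real.toNNReal (1 / η), fun ε hε hε1 Q hQ _ => ?_⟩
    have h1 := hc P hP η _ hη hlam (hsmall η le_rfl) Q hQ ε hε hε1
    rw [hdiv _ hδ, ENNReal.ofReal_ofNat, mul_add] at h1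
    calc Polaron.averaged ε Polaron.coulomb Q
        ≤ Polaron.averaged ε (Polaron.coulombReg η) Q
          + Polaron.averaged ε (Polaron.coulombSing η) Q := Polaron.averaged_coulomb_le η ε Q
      _ ≤ 2 * ENNReal.ofReal (1 / η)
          + (ENNReal.ofReal δ * Polaron.specificEntropy Q P + ENNReal.ofReal δ * 2) :=
          add_le_add (Polaron.averaged_coulombReg_le hη hε hε1 Q) h1
      _ = _ := by
          push_cast
          simp only [ENNReal.ofReal]
          ring
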